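/- Let $\sigma_0>0$, $\lambda\in\mathbb R\setminus\{0\}$ and $T>0$. For $i\in\mathbb Z$ let $\mathcal H_i=L^2(\mathbb R)$ and let $x_i,y_i\in\mathcal H_i$ be the normalized Gaussians $$x_i(z)=(2\pi\sigma_0^2)^{-1/4}e^{-(z-\lambda T)^2/(4\sigma_0^2)},\qquad y_i(z)=(2\pi\sigma_0^2)^{-1/4}e^{-(z+\lambda T)^2/(4\sigma_0^2)} .$$ A family $(u_i)_{i\in\mathbb Z}$, $u_i\in\mathcal H_i$, is a $C_0$ family if $\sum_i|\,\|u_i\|-1|<\infty$, and two $C_0$ families $u,v$ are equivalent if $\sum_i|(u_i,v_i)-1|<\infty$. The complete tensor product is the Hilbert space generated by product vectors $\otimes_i u_i$, one for each $C_0$ family, with $(\otimes_i u_i,\otimes_i v_i)=\prod_i(u_i,v_i)$ if $u,v$ are equivalent and $0$ otherwise. The incomplete tensor product space (IDPS) of a $C_0$ family $\zeta$ is the closed linear span of the $\otimes_i u_i$ with $u$ equivalent to $\zeta$. Let $\mathcal A_i$ be the von Neumann algebra on $\mathcal H_i$ generated by the Weyl operators $\exp[i(\beta z_i+\gamma p_i)]$,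 $\beta,\gamma\in\mathbb R$, $p=-i\,d/dz$, and let $\mathcal A=\bigotimes_{i\in\mathbb Z}\mathcal A_i$ be the infinite tensor product C*-algebra, i.e. the C*-algebra generated on the complete tensor product by the operators $\otimes_i a_i$ with $a_i\in\mathcal A_i$ and $a_i=1$ for all but finitely many $i$; it leaves every IDPS invariant, so that every IDPS carries a representation of $\mathcal A$. Then the center of mass coordinate exists in the sense that, for every $\rho\in\mathbb R$, $$\lim_{k\to\infty}\exp\Big(i\rho\,\frac{\sum_{i=-k}^{k}z_i}{2k+1}\Big)=e^{i\rho\lambda T}\,\mathbf 1$$ in the strong operator topology on the IDPS of $(x_i)_{i\in\mathbb Z}$, and $$\lim_{k\to\infty}\exp\Big(i\rho\,\frac{\sum_{i=-k}^{k}z_i}{2k+1}\Big)=e^{-i\rho\lambda T}\,\mathbf 1$$ in the strong operator topology on the IDPS of $(y_i)_{i\in\mathbb Z}$. Moreover the representations of $\mathcal A$ on these two IDPS are disjoint: no nonzero subrepresentation of the one is unitarily equivalent to a subrepresentation of the other. -/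

import Mathlib

open Filter Topology MeasureTheory
open scoped ENNReal

namespace InfTensor

section Kernels

open scoped ComplexOrder

variable {𝕜 X ι : Type*} [RCLike 𝕜]

theorem posSemidef_of_tendsto {α : Type*} {l : Filter α} [l.NeBot] {M : α → Matrix X X 𝕜}
    {L : Matrix X X 𝕜} (hM : ∀ a, (M a).PosSemidef)
    (h : ∀ x y, Tendsto (fun a => M a x y) l (𝓝 (L x y))) : L.PosSemidef := by
  refine ⟨?_, fun c => ?_⟩
  · ext x y
    have h1 : Tendsto (fun a => star (M a y x)) l (𝓝 (star (L y x))) := (h y x).star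
    have h2 : (fun a => star (M a y x)) = fun a => M a x y := by
      funext a; exact (hM a).1.apply x y
    rw [h2] at h1
    exact tendsto_nhds_unique h1 (h x y)
  · refine ge_of_tendsto' (f := fun a => c.sum fun i xi => c.sum fun j xj => star xi * M a i j * xj)
      (x := l) ?_ (fun a => (hM a).2 c)
    refine tendsto_finsetSum _ fun i _ => tendsto_finsetSum _ fun j _ => ?_
    exact ((h i j).const_mul _).mul_const _

theorem posSemidef_gram' {V : Type*} [NormedAddCommGroup V] [InnerProductSpace 𝕜 V] (v : X → V) :
    (Matrix.gram 𝕜 v).PosSemidef := by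
  refine ⟨Matrix.isHermitian_gram 𝕜 v, fun c => ?_⟩
  have : (c.sum fun i xi => c.sum fun j xj => star xi * Matrix.gram 𝕜 v i j * xj)
      = inner 𝕜 (c.sum fun i xi => xi • v i) (c.sum fun i xi => xi • v i) := by
    simp only [Finsupp.sum, sum_inner, inner_sum, inner_smul_left, inner_smul_right,
      Matrix.gram_apply, Finset.mul_sum]
    rw [Finset.sum_comm]
    refine Finset.sum_congr rfl fun i _ => Finset.sum_congr rfl fun j _ => ?_
    simp only [RCLike.star_def]; ring
  rw [this, inner_self_eq_norm_sq_to_K]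
  exact_mod_cast sq_nonneg ‖c.sum fun i xi => xi • v i‖

theorem posSemidef_one_const : (Matrix.of fun _ _ : X => (1 : 𝕜)).PosSemidef := by
  have := posSemidef_gram' (𝕜 := 𝕜) (fun _ : X => (1 : 𝕜))
  have e : (Matrix.of fun _ _ : X => (1 : 𝕜)) = Matrix.gram 𝕜 (fun _ : X => (1 : 𝕜)) := by
    ext x y
    simp [Matrix.gram_apply]
  rwa [e]

theorem posSemidef_prod {M : ι → Matrix X X 𝕜} (hM : ∀ i, (M i).PosSemidef) (F : Finset ι) :
    (Matrix.of fun x y => ∏ i ∈ F, M i x y).PosSemidef := by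
  classical
  induction F using Finset.induction_on with
  | empty => simpa using posSemidef_one_const
  | insert i F hi ih =>
    have e : (Matrix.of fun x y => ∏ j ∈ insert i F, M j x y)
        = (M i).hadamard (Matrix.of fun x y => ∏ i ∈ F, M i x y) := by
      ext x y
      simp [Finset.prod_insert hi, Matrix.hadamard]
    rw [e]
    exact (hM i).hadamard ih

open Classical in
theorem posSemidef_block (s : Setoid X) :
    (Matrix.of fun x y => if s x y then (1 : 𝕜) else 0).PosSemidef := by
  have h := (Matrix.PosSemidef.one (n := Quotient s) (R := 𝕜)).submatrix (Quotient.mk s)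
  have e : (Matrix.of fun x y => if s x y then (1 : 𝕜) else 0)
      = (1 : Matrix (Quotient s) (Quotient s) 𝕜).submatrix (Quotient.mk s) (Quotient.mk s) := by
    ext x y
    by_cases hxy : s x y
    · simp [Matrix.one_apply, hxy, Quotient.sound hxy]
    · simp only [Matrix.of_apply, hxy, if_false, Matrix.submatrix_apply]
      rw [Matrix.one_apply_ne]
      exact fun h => hxy (Quotient.exact h)
  rwa [e]

open Classical in
theorem posSemidef_tprod (s : Setoid X) {M : ι → Matrix X X 𝕜} (hM : ∀ i, (M i).PosSemidef)
    (hm : ∀ x y, s x y → Multipliable fun i => M i x y) :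
    (Matrix.of fun x y => if s x y then ∏' i, M i x y else 0).PosSemidef := by
  refine posSemidef_of_tendsto (l := (atTop : Filter (Finset ι)))
    (fun F => (posSemidef_block s).hadamard (posSemidef_prod hM F)) fun x y => ?_
  by_cases h : s x y
  · have h1 : Tendsto (fun F => ∏ i ∈ F, M i x y) atTop (𝓝 (∏' i, M i x y)) := by
      simpa [HasProd] using (hm x y h).hasProd
    simpa [Matrix.hadamard, h] using h1
  · simp [Matrix.hadamard, h]

end Kernels

section Families

variable {ι : Type*} (E : ι → Type*) [∀ i, NormedAddCommGroup (E i)]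

/-- The `C₀` families of vectors: `∑ |‖x i‖ - 1| < ∞`. -/
def C0Family : Type _ := {x : ∀ i, E i // Summable fun i => |‖x i‖ - 1|}

variable {E}

namespace C0Family

instance : CoeFun (C0Family E) fun _ => ∀ i, E i := ⟨Subtype.val⟩

theorem summable_sq (x : C0Family E) : Summable fun i => |‖x i‖ ^ 2 - 1| := by
  have h := x.2
  have hb : ∀ᶠ i in cofinite, |‖x i‖ ^ 2 - 1| ≤ 3 * |‖x i‖ - 1| := by
    filter_upwards [h.tendsto_cofinite_zero.eventually_lt_const (zero_lt_one)] with i hi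
    have : ‖x i‖ ^ 2 - 1 = (‖x i‖ + 1) * (‖x i‖ - 1) := by ring
    rw [this, abs_mul]
    refine mul_le_mul_of_nonneg_right ?_ (abs_nonneg _)
    rw [abs_lt] at hi
    rw [abs_le]; constructor <;> linarith [norm_nonneg (x i)]
  exact (h.mul_left 3).of_norm_bounded_eventually (by simpa using hb)

variable [∀ i, InnerProductSpace ℂ (E i)]

/-- Equivalence of `C₀` families: `∑ |⟪x i, y i⟫ - 1| < ∞`. -/
def Equiv (x y : C0Family E) : Prop := Summable fun i => ‖inner ℂ (x i) (y i) - 1‖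

theorem equiv_refl (x : C0Family E) : Equiv x x := by
  refine x.summable_sq.congr fun i => ?_
  rw [inner_self_eq_norm_sq_to_K]
  rw [← Real.norm_eq_abs, ← Complex.norm_real]
  push_cast; rfl

theorem Equiv.symm {x y : C0Family E} (h : Equiv x y) : Equiv y x := by
  refine Summable.congr h fun i => ?_
  rw [← inner_conj_symm, ← Complex.norm_conj]
  simp

theorem Equiv.summable_sub {x y : C0Family E} (h : Equiv x y) :
    Summable fun i => ‖x i - y i‖ ^ 2 := by
  refine Summable.of_nonneg_of_le (fun _ => by positivity) (fun i => ?_)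
    ((x.summable_sq.add y.summable_sq).add (Summable.mul_left 2 h))
  rw [@norm_sub_sq ℂ]
  have h1 := le_abs_self (‖x i‖ ^ 2 - 1)
  have h2 := le_abs_self (‖y i‖ ^ 2 - 1)
  have h3 := (Complex.abs_re_le_norm (inner ℂ (x i) (y i) - 1))
  have h4 := neg_abs_le ((inner ℂ (x i) (y i) - 1).re)
  simp only [Complex.sub_re, Complex.one_re] at h3 h4
  simp only [RCLike.re_to_complex]
  linarith

theorem Equiv.trans {x y z : C0Family E} (h : Equiv x y) (h' : Equiv y z) : Equiv x z := by
  have hs := (((h.summable_sub.add h'.summable_sub).add h).add h').add y.summable_sq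
  refine Summable.of_nonneg_of_le (fun _ => norm_nonneg _) (fun i => ?_) hs
  have e : inner ℂ (x i) (z i) - 1 = -inner ℂ (x i - y i) (y i - z i)
      + (inner ℂ (x i) (y i) - 1) + (inner ℂ (y i) (z i) - 1) - ((‖y i‖ ^ 2 - 1 : ℝ) : ℂ) := by
    have := inner_self_eq_norm_sq_to_K (𝕜 := ℂ) (y i)
    simp only [inner_sub_left, inner_sub_right, this]
    push_cast
    simp only [Complex.coe_algebraMap]
    ring
  have e1 : ‖inner ℂ (x i - y i) (y i - z i)‖ ≤ ‖x i - y i‖ ^ 2 + ‖y i - z i‖ ^ 2 := by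
    refine (norm_inner_le_norm _ _).trans ?_
    nlinarith [sq_nonneg (‖x i - y i‖ - ‖y i - z i‖), sq_nonneg (‖x i - y i‖),
      sq_nonneg (‖y i - z i‖)]
  rw [e]
  refine (norm_sub_le _ _).trans ?_
  refine add_le_add ((norm_add_le _ _).trans (add_le_add ((norm_add_le _ _).trans
    (add_le_add ?_ le_rfl)) le_rfl)) ?_
  · rwa [norm_neg]
  · rw [Complex.norm_real, Real.norm_eq_abs]

/-- Equivalence of `C₀` families, as a setoid. -/
instance setoid : Setoid (C0Family E) where
  r := Equiv
  iseqv := ⟨equiv_refl, Equiv.symm, Equiv.trans⟩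

theorem Equiv.multipliable {x y : C0Family E} (h : Equiv x y) :
    Multipliable fun i => inner ℂ (x i) (y i) := by
  have := multipliable_one_add_of_summable (R := ℂ) h
  simpa using this

end C0Family

end Families

section Product

variable {ι : Type*} {E : ι → Type*} [∀ i, NormedAddCommGroup (E i)]
  [∀ i, InnerProductSpace ℂ (E i)]

open Classical in
/-- The inner product of the product vectors `⊗ x i` and `⊗ y i`: it is `∏ ⟪x i, y i⟫` if the
families are equivalent, and `0` otherwise. -/
noncomputable def prodInner (x y : C0Family E) : ℂ :=
  if x.Equiv y then ∏' i, inner ℂ (x i) (y i) else 0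

open scoped ComplexOrder in
theorem prodInner_pos (c : C0Family E →₀ ℂ) :
    0 ≤ (c.sum fun i xi => c.sum fun j xj => star xi * prodInner i j * xj).re := by
  have h := (posSemidef_tprod C0Family.setoid
    (M := fun i => Matrix.gram ℂ fun x : C0Family E => x i)
    (fun i => posSemidef_gram' _) (fun _ _ h => C0Family.Equiv.multipliable h)).2 c
  exact (Complex.le_def.1 h).1

theorem prodInner_conj (x y : C0Family E) : star (prodInner x y) = prodInner y x := by
  unfold prodInner
  by_cases h : x.Equiv y
  · rw [if_pos h, if_pos h.symm]
    have h1 := h.multipliable.hasProd.map (starRingEnd ℂ) Complex.continuous_conj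
    rw [← starRingEnd_apply, ← h1.tprod_eq]
    exact tprod_congr fun i => inner_conj_symm _ _
  · rw [if_neg h, if_neg fun h' => h h'.symm, star_zero]

variable (E) in
/-- `prodInner` as an operator valued kernel. -/
noncomputable def prodKernel : Matrix (C0Family E) (C0Family E) (ℂ →L[ℂ] ℂ) :=
  Matrix.of fun x y => prodInner x y • ContinuousLinearMap.id ℂ ℂ

theorem posSemidef_prodKernel : (prodKernel E).PosSemidef := by
  have key : (prodKernel E).IsHermitian ∧ ∀ (vv : C0Family E →₀ ℂ),
    0 ≤ RCLike.re (vv.sum fun x w ↦ vv.sum fun x' w' ↦ inner ℂ (prodKernel E x' x w) w') := by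
    refine ⟨?_, fun v => ?_⟩
    · ext x y
      refine ext_inner_right ℂ fun w => ?_
      rw [Matrix.conjTranspose_apply, ContinuousLinearMap.star_eq_adjoint,
        ContinuousLinearMap.adjoint_inner_left]
      simp [prodKernel, ← prodInner_conj x y, mul_comm]
    · have h := prodInner_pos v
      refine h.trans_eq (congrArg Complex.re ?_)
      refine Finset.sum_congr rfl fun i _ => Finset.sum_congr rfl fun j _ => ?_
      simp [prodKernel, ← prodInner_conj i j]
      ring
  exact (RKHS.posSemidef_tfae.out 0 2).mpr key

instance : Fact (prodKernel E).PosSemidef := ⟨posSemidef_prodKernel⟩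

variable (E) in
/-- The complete tensor product `⊗ E i`: the Hilbert space generated by product vectors `⊗ x i`,
one for every `C₀` family `x`, with the inner products `prodInner`. -/
def CTP : Type _ := RKHS.OfKernel (prodKernel E)

namespace CTP

noncomputable instance : NormedAddCommGroup (CTP E) :=
  inferInstanceAs (NormedAddCommGroup (RKHS.OfKernel (prodKernel E)))

noncomputable instance : InnerProductSpace ℂ (CTP E) :=
  inferInstanceAs (InnerProductSpace ℂ (RKHS.OfKernel (prodKernel E)))

instance : CompleteSpace (CTP E) :=
  inferInstanceAs (CompleteSpace (RKHS.OfKernel (prodKernel E)))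

/-- The product vector `⊗ x i`. -/
noncomputable def tprod (x : C0Family E) : CTP E :=
  RKHS.kerFun (RKHS.OfKernel (prodKernel E)) x (1 : ℂ)

theorem inner_tprod (x y : C0Family E) : inner ℂ (tprod x) (tprod y) = prodInner x y := by
  have h := RKHS.kernel_inner (RKHS.OfKernel (prodKernel E)) y x (1 : ℂ) (1 : ℂ)
  rw [RKHS.OfKernel.kernel_ofKernel] at h
  refine h.symm.trans ?_
  simp [prodKernel, ← prodInner_conj y x]

theorem dense_span_tprod :
    (Submodule.span ℂ (Set.range (tprod (E := E)))).topologicalClosure = ⊤ := by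
  have h := RKHS.kerFun_dense (RKHS.OfKernel (prodKernel E))
  refine top_le_iff.1 (h.symm.le.trans (Submodule.topologicalClosure_mono ?_))
  refine Submodule.span_le.2 ?_
  rintro _ ⟨x, v, rfl⟩
  have : RKHS.kerFun (RKHS.OfKernel (prodKernel E)) x v = v • tprod x := by
    have h2 := (RKHS.kerFun (RKHS.OfKernel (prodKernel E)) x).map_smul v 1
    rw [smul_eq_mul, mul_one] at h2
    exact h2
  have h3 : v • tprod x ∈ Submodule.span ℂ (Set.range (tprod (E := E))) :=
    Submodule.smul_mem _ _ (Submodule.subset_span ⟨x, rfl⟩)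
  rw [← this] at h3
  exact h3

end CTP
end Product

section LocalOperators

variable {ι : Type*} {E : ι → Type*} [∀ i, NormedAddCommGroup (E i)]
  [∀ i, InnerProductSpace ℂ (E i)]

open Classical in
/-- The family `a i (x i)` for `i ∈ F`, `x i` for `i ∉ F`. -/
noncomputable def mapFamily (F : Finset ι) (a : ∀ i, E i →L[ℂ] E i) (x : C0Family E) :
    C0Family E :=
  ⟨fun i => if i ∈ F then a i (x i) else x i, by
    refine x.2.congr_cofinite ?_
    filter_upwards [F.finite_toSet.compl_mem_cofinite] with i hi
    have : i ∉ F := hi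
    simp [this]⟩

theorem mapFamily_of_mem {F : Finset ι} {i : ι} (h : i ∈ F) (a : ∀ i, E i →L[ℂ] E i)
    (x : C0Family E) : mapFamily F a x i = a i (x i) := if_pos h

theorem mapFamily_of_notMem {F : Finset ι} {i : ι} (h : i ∉ F) (a : ∀ i, E i →L[ℂ] E i)
    (x : C0Family E) : mapFamily F a x i = x i := if_neg h

theorem mapFamily_equiv (F : Finset ι) (a : ∀ i, E i →L[ℂ] E i) (x : C0Family E) :
    (mapFamily F a x).Equiv x := by
  refine Summable.congr_cofinite (C0Family.equiv_refl x) ?_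
  filter_upwards [F.finite_toSet.compl_mem_cofinite] with i hi
  rw [mapFamily_of_notMem hi]

theorem mapFamily_insert [DecidableEq ι] {F : Finset ι} {i : ι} (hi : i ∉ F)
    (a : ∀ i, E i →L[ℂ] E i) (x : C0Family E) :
    mapFamily (insert i F) a x = mapFamily {i} a (mapFamily F a x) := by
  refine Subtype.ext (funext fun j => ?_)
  by_cases h : j = i
  · subst h
    rw [mapFamily_of_mem (Finset.mem_insert_self _ _),
      mapFamily_of_mem (Finset.mem_singleton_self _), mapFamily_of_notMem hi]
  · rw [mapFamily_of_notMem (by simpa using h) a (mapFamily F a x)]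
    by_cases hj : j ∈ F
    · rw [mapFamily_of_mem hj, mapFamily_of_mem (Finset.mem_insert_of_mem hj)]
    · rw [mapFamily_of_notMem hj, mapFamily_of_notMem (by simp [h, hj])]

theorem inner_sum_tprod (c : C0Family E →₀ ℂ) (φ : C0Family E → C0Family E) :
    ((c.sum fun i xi => c.sum fun j xj => star xi * prodInner (φ i) (φ j) * xj).re) =
      ‖Finsupp.linearCombination ℂ (fun x => CTP.tprod (φ x)) c‖ ^ 2 := by
  rw [← inner_self_eq_norm_sq (𝕜 := ℂ)]
  simp only [Finsupp.linearCombination_apply, Finsupp.sum, sum_inner, inner_sum, inner_smul_left,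
    inner_smul_right, CTP.inner_tprod, RCLike.re_to_complex, Finset.mul_sum]
  rw [Finset.sum_comm]
  refine congrArg Complex.re (Finset.sum_congr rfl fun i _ => Finset.sum_congr rfl fun j _ => ?_)
  simp only [RCLike.star_def]; ring

open scoped ComplexOrder in
theorem norm_mapFamily_singleton_le (i : ι) (a : ∀ i, E i →L[ℂ] E i) (c : C0Family E →₀ ℂ) :
    ‖Finsupp.linearCombination ℂ (fun x => CTP.tprod (mapFamily {i} a x)) c‖
      ≤ ‖a i‖ * ‖Finsupp.linearCombination ℂ CTP.tprod c‖ := by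
  classical
  set N : Matrix (C0Family E) (C0Family E) ℂ := ‖a i‖ ^ 2 • Matrix.gram ℂ (fun x => x i) -
    Matrix.gram ℂ (a i ∘ fun x => x i) with hN
  have hNp := Matrix.posSemidef_opNorm_smul_gram_sub_gram (𝕜 := ℂ)
    (fun x : C0Family E => x i) (a i)
  let G : ι → Matrix (C0Family E) (C0Family E) ℂ := fun j => Matrix.gram ℂ fun x => x j
  have hup : ∀ (x y : C0Family E) (b : ℂ), x.Equiv y →
      Multipliable (Function.update (fun j => G j x y) i b) := by
    intro x y b h
    have h1 : Summable fun j => ‖Function.update (fun j => G j x y) i b j - 1‖ := by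
      refine Summable.congr_cofinite h ?_
      filter_upwards [(Set.finite_singleton i).compl_mem_cofinite] with j hj
      have : j ≠ i := hj
      simp [Function.update_of_ne this, G]
    simpa using multipliable_one_add_of_summable (R := ℂ) h1
  have hval : ∀ (x y : C0Family E) (b : ℂ), x.Equiv y →
      ∏' j, Function.update (fun j => G j x y) i b j = b * ∏' j, ite (j = i) 1 (G j x y) := by
    intro x y b h
    have := Multipliable.tprod_eq_mul_tprod_ite' (f := Function.update (fun j => G j x y) i b) i
      (by rw [Function.update_idem]; exact hup x y 1 h)
    rw [this, Function.update_self]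
    congr 1
    refine tprod_congr fun j => ?_
    by_cases hj : j = i <;> simp [hj]
  have hpos := (posSemidef_tprod (𝕜 := ℂ) C0Family.setoid
    (M := fun j => if j = i then N else G j)
    (fun j => by
      by_cases hj : j = i
      · simpa [hj] using hNp
      · simpa [hj] using posSemidef_gram' _)
    (fun x y h => by
      refine (hup x y (N x y) h).congr fun j => ?_
      by_cases hj : j = i
      · subst hj; simp
      · simp [hj])).2 c
  have hD : ∀ x y : C0Family E,
      (if C0Family.setoid x y then ∏' j, (if j = i then N else G j) x y else 0)
        = ((‖a i‖ ^ 2 : ℝ) : ℂ) * prodInner x y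
          - prodInner (mapFamily {i} a x) (mapFamily {i} a y) := by
    intro x y
    by_cases h : x.Equiv y
    · have h' : (mapFamily {i} a x).Equiv (mapFamily {i} a y) :=
        ((mapFamily_equiv _ _ x).trans h).trans (mapFamily_equiv _ _ y).symm
      have e0 : C0Family.setoid x y := h
      rw [if_pos e0]
      unfold prodInner
      rw [if_pos h, if_pos h']
      have e1 : ∏' j, (if j = i then N else G j) x y
          = ∏' j, Function.update (fun j => G j x y) i (N x y) j :=
        tprod_congr fun j => by
          by_cases hj : j = i
          · subst hj; simp
          · simp [hj]
      have e2 : ∏' j, inner ℂ (x j) (y j)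
          = ∏' j, Function.update (fun j => G j x y) i (G i x y) j :=
        tprod_congr fun j => by rw [Function.update_eq_self]; rfl
      have e3 : ∏' j, inner ℂ (mapFamily {i} a x j) (mapFamily {i} a y j)
          = ∏' j, Function.update (fun j => G j x y) i (inner ℂ (a i (x i)) (a i (y i))) j :=
        tprod_congr fun j => by
          by_cases hj : j = i
          · subst hj
            rw [mapFamily_of_mem (Finset.mem_singleton_self _),
              mapFamily_of_mem (Finset.mem_singleton_self _), Function.update_self]
          · rw [mapFamily_of_notMem (by simpa using hj), mapFamily_of_notMem (by simpa using hj),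
              Function.update_of_ne hj]; rfl
      rw [e1, e2, e3, hval _ _ _ h, hval _ _ _ h, hval _ _ _ h]
      have e4 : N x y = ((‖a i‖ ^ 2 : ℝ) : ℂ) * G i x y - inner ℂ (a i (x i)) (a i (y i)) := by
        simp [hN, G, Matrix.sub_apply, Matrix.smul_apply, Matrix.gram_apply]
      rw [e4]; ring
    · have h' : ¬ (mapFamily {i} a x).Equiv (mapFamily {i} a y) := fun h1 =>
        h (((mapFamily_equiv _ _ x).symm.trans h1).trans (mapFamily_equiv _ _ y))
      have e0 : ¬ C0Family.setoid x y := h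
      rw [if_neg e0]
      unfold prodInner
      rw [if_neg h, if_neg h']; simp
  have hre := (Complex.le_def.1 hpos).1
  have hfin : 0 ≤ ‖a i‖ ^ 2 * ‖Finsupp.linearCombination ℂ CTP.tprod c‖ ^ 2 -
      ‖Finsupp.linearCombination ℂ (fun x => CTP.tprod (mapFamily {i} a x)) c‖ ^ 2 := by
    have h0 := inner_sum_tprod c id
    simp only [id] at h0
    rw [← inner_sum_tprod c (mapFamily {i} a), ← h0]
    refine hre.trans_eq ?_
    rw [← Complex.re_ofReal_mul, ← Complex.sub_re]
    refine congrArg Complex.re ?_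
    simp only [Finsupp.sum, Finset.mul_sum, ← Finset.sum_sub_distrib]
    refine Finset.sum_congr rfl fun x _ => Finset.sum_congr rfl fun y _ => ?_
    rw [Matrix.of_apply, hD]
    ring
  refine le_of_sq_le_sq ?_ (by positivity)
  rw [mul_pow]; linarith

theorem CTP.denseRange_linearCombination :
    DenseRange (Finsupp.linearCombination ℂ (CTP.tprod (E := E))) := by
  have h := CTP.dense_span_tprod (E := E)
  rw [← Finsupp.range_linearCombination] at h
  exact (Submodule.dense_iff_topologicalClosure_eq_top.2 h)

theorem exists_localOp (F : Finset ι) (a : ∀ i, E i →L[ℂ] E i) :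
    ∃ T : CTP E →L[ℂ] CTP E, ∀ x, T (CTP.tprod x) = CTP.tprod (mapFamily F a x) := by
  classical
  induction F using Finset.induction_on with
  | empty =>
    refine ⟨ContinuousLinearMap.id ℂ _, fun x => ?_⟩
    have : mapFamily ∅ a x = x :=
      Subtype.ext (funext fun j => mapFamily_of_notMem (by simp) a x)
    rw [this]; rfl
  | insert i F hi ih =>
    obtain ⟨T, hT⟩ := ih
    refine ⟨((Finsupp.linearCombination ℂ fun x => CTP.tprod (mapFamily {i} a x)).extendOfNorm
      (Finsupp.linearCombination ℂ CTP.tprod)).comp T, fun x => ?_⟩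
    have h := LinearMap.extendOfNorm_eq CTP.denseRange_linearCombination
      ⟨_, norm_mapFamily_singleton_le i a⟩ (Finsupp.single (mapFamily F a x) 1)
    simp only [Finsupp.linearCombination_single, one_smul] at h
    rw [ContinuousLinearMap.comp_apply, hT, h, mapFamily_insert hi]

/-- The local operator `⊗_{i ∈ F} a i ⊗ 1` on the complete tensor product: the bounded operator
that maps every product vector `⊗ x i` to the product vector with the factors `a i (x i)` for
`i ∈ F` and `x i` for `i ∉ F`. -/
noncomputable def localOp (F : Finset ι) (a : ∀ i, E i →L[ℂ] E i) : CTP E →L[ℂ] CTP E :=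
  (exists_localOp F a).choose

theorem localOp_tprod (F : Finset ι) (a : ∀ i, E i →L[ℂ] E i) (x : C0Family E) :
    localOp F a (CTP.tprod x) = CTP.tprod (mapFamily F a x) :=
  (exists_localOp F a).choose_spec x

theorem CTP.ext_tprod {S T : CTP E →L[ℂ] CTP E} (h : ∀ x, S (tprod x) = T (tprod x)) : S = T := by
  refine ContinuousLinearMap.ext_on
    (Submodule.dense_iff_topologicalClosure_eq_top.2 CTP.dense_span_tprod) ?_
  rintro _ ⟨x, rfl⟩
  exact h x

theorem star_localOp [∀ i, CompleteSpace (E i)] (F : Finset ι) (a : ∀ i, E i →L[ℂ] E i) :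
    star (localOp F a) = localOp F fun i => star (a i) := by
  refine CTP.ext_tprod fun x => ?_
  rw [ContinuousLinearMap.star_eq_adjoint]
  have hd : Dense (Submodule.span ℂ (Set.range (CTP.tprod (E := E))) : Set (CTP E)) :=
    Submodule.dense_iff_topologicalClosure_eq_top.2 CTP.dense_span_tprod
  have key : ∀ y : C0Family E, inner ℂ (ContinuousLinearMap.adjoint (localOp F a) (CTP.tprod x))
      (CTP.tprod y) = inner ℂ (localOp F (fun i => star (a i)) (CTP.tprod x)) (CTP.tprod y) := by
    intro y
    rw [ContinuousLinearMap.adjoint_inner_left, localOp_tprod, localOp_tprod, CTP.inner_tprod,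
      CTP.inner_tprod]
    unfold prodInner
    have h1 : x.Equiv (mapFamily F a y) ↔ (mapFamily F (fun i => star (a i)) x).Equiv y :=
      ⟨fun h => (mapFamily_equiv _ _ _).trans (h.trans (mapFamily_equiv _ _ _)),
       fun h => (mapFamily_equiv _ _ _).symm.trans (h.trans (mapFamily_equiv _ _ _).symm)⟩
    have h2 : ∏' i, inner ℂ (x i) (mapFamily F a y i)
        = ∏' i, inner ℂ (mapFamily F (fun i => star (a i)) x i) (y i) :=
      tprod_congr fun i => by
        by_cases hi : i ∈ F
        · rw [mapFamily_of_mem hi, mapFamily_of_mem hi, ContinuousLinearMap.star_eq_adjoint,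
            ContinuousLinearMap.adjoint_inner_left]
        · rw [mapFamily_of_notMem hi, mapFamily_of_notMem hi]
    by_cases h : x.Equiv (mapFamily F a y)
    · rw [if_pos h, if_pos (h1.1 h), h2]
    · rw [if_neg h, if_neg fun h' => h (h1.2 h')]
  refine hd.eq_of_inner_left ℂ fun v hv => ?_
  induction hv using Submodule.span_induction with
  | mem v hv => obtain ⟨y, rfl⟩ := hv; exact key y
  | zero => simp
  | add v w _ _ hv hw => rw [inner_add_right, inner_add_right, hv, hw]
  | smul c v _ hv => rw [inner_smul_right, inner_smul_right, hv]

end LocalOperators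

section Representations

/-- Restriction of a *-algebra of bounded operators to a closed invariant subspace, as a
*-representation. -/
noncomputable def restrictRep {H : Type*} [NormedAddCommGroup H] [InnerProductSpace ℂ H]
    [CompleteSpace H] (A : StarSubalgebra ℂ (H →L[ℂ] H)) (M : Submodule ℂ H) [CompleteSpace M]
    (hM : ∀ a ∈ A, ∀ v ∈ M, a v ∈ M) : A →⋆ₐ[ℂ] (M →L[ℂ] M) where
  toFun a := ((a : H →L[ℂ] H).comp M.subtypeL).codRestrict M fun v => hM a a.2 v v.2
  map_one' := rfl
  map_mul' _ _ := rfl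
  map_zero' := rfl
  map_add' _ _ := rfl
  commutes' _ := rfl
  map_star' a := by
    rw [ContinuousLinearMap.star_eq_adjoint, ContinuousLinearMap.eq_adjoint_iff]
    intro v w
    exact ContinuousLinearMap.adjoint_inner_left (a : H →L[ℂ] H) (w : H) (v : H)

/-- Two representations are disjoint if no nonzero subrepresentation of the first (restriction to a
nonzero closed invariant subspace) is unitarily equivalent to a subrepresentation of the second. -/
def DisjointReps {A H₁ H₂ : Type*} [Semiring A] [Algebra ℂ A] [Star A]
    [NormedAddCommGroup H₁] [InnerProductSpace ℂ H₁] [CompleteSpace H₁]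
    [NormedAddCommGroup H₂] [InnerProductSpace ℂ H₂] [CompleteSpace H₂]
    (π₁ : A →⋆ₐ[ℂ] (H₁ →L[ℂ] H₁)) (π₂ : A →⋆ₐ[ℂ] (H₂ →L[ℂ] H₂)) : Prop :=
  ∀ (M₁ : Submodule ℂ H₁) (M₂ : Submodule ℂ H₂),
    IsClosed (M₁ : Set H₁) → IsClosed (M₂ : Set H₂) → M₁ ≠ ⊥ →
    ∀ (h₁ : ∀ a, ∀ v ∈ M₁, π₁ a v ∈ M₁) (h₂ : ∀ a, ∀ w ∈ M₂, π₂ a w ∈ M₂),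
      ¬ ∃ U : M₁ ≃ₗᵢ[ℂ] M₂, ∀ (a : A) (v : M₁),
        U ⟨π₁ a v, h₁ a v v.2⟩ = ⟨π₂ a (U v), h₂ a (U v) (U v).2⟩

variable {ι : Type*} {E : ι → Type*} [∀ i, NormedAddCommGroup (E i)]
  [∀ i, InnerProductSpace ℂ (E i)]

/-- The incomplete tensor product space of the `C₀` family `ζ`: the closed linear span, in the
complete tensor product, of the product vectors of the `C₀` families equivalent to `ζ`. -/
noncomputable def idps (ζ : C0Family E) : Submodule ℂ (CTP E) :=
  (Submodule.span ℂ (CTP.tprod '' {x | x.Equiv ζ})).topologicalClosure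

instance (ζ : C0Family E) : CompleteSpace (idps ζ) :=
  (Submodule.isClosed_topologicalClosure _).completeSpace_coe

theorem localOp_mem_idps (F : Finset ι) (a : ∀ i, E i →L[ℂ] E i) (ζ : C0Family E) :
    ∀ v ∈ idps ζ, localOp F a v ∈ idps ζ := by
  intro v hv
  have hmap : Set.MapsTo (localOp F a)
      (Submodule.span ℂ (CTP.tprod '' {x : C0Family E | x.Equiv ζ}) : Set (CTP E))
      (Submodule.span ℂ (CTP.tprod '' {x : C0Family E | x.Equiv ζ}) : Set (CTP E)) := by
    intro w hw
    induction hw using Submodule.span_induction with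
    | mem w hw =>
      obtain ⟨x, hx, rfl⟩ := hw
      rw [localOp_tprod]
      exact Submodule.subset_span ⟨_, (mapFamily_equiv F a x).trans hx, rfl⟩
    | zero => rw [map_zero]; exact Submodule.zero_mem _
    | add v w _ _ hv hw => rw [map_add]; exact Submodule.add_mem _ hv hw
    | smul c v _ hv => rw [map_smul]; exact Submodule.smul_mem _ c hv
  exact hmap.closure (localOp F a).continuous hv

variable [∀ i, CompleteSpace (E i)]

/-- The infinite tensor product C*-algebra `⊗ A i` of algebras `A i` of bounded operators on the
`E i`: the C*-algebra generated, on the complete tensor product, by the local operators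
`⊗_{i ∈ F} a i ⊗ 1` with `F` finite and `a i ∈ A i`. -/
noncomputable def tensorAlgebra (A : ∀ i, StarSubalgebra ℂ (E i →L[ℂ] E i)) :
    StarSubalgebra ℂ (CTP E →L[ℂ] CTP E) :=
  (StarAlgebra.adjoin ℂ
    {T | ∃ (F : Finset ι) (a : ∀ i, E i →L[ℂ] E i),
      (∀ i ∈ F, a i ∈ A i) ∧ T = localOp F a}).topologicalClosure

theorem localOp_mem_tensorAlgebra {A : ∀ i, StarSubalgebra ℂ (E i →L[ℂ] E i)} {F : Finset ι}
    {a : ∀ i, E i →L[ℂ] E i} (h : ∀ i ∈ F, a i ∈ A i) : localOp F a ∈ tensorAlgebra A :=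
  StarSubalgebra.le_topologicalClosure _ (StarAlgebra.subset_adjoin ℂ _ ⟨F, a, h, rfl⟩)

theorem tensorAlgebra_mem_idps (A : ∀ i, StarSubalgebra ℂ (E i →L[ℂ] E i)) (ζ : C0Family E) :
    ∀ T ∈ tensorAlgebra A, ∀ v ∈ idps ζ, T v ∈ idps ζ := by
  intro T hT v hv
  have hcl : IsClosed (idps ζ : Set (CTP E)) := Submodule.isClosed_topologicalClosure _
  have key : ∀ T ∈ StarAlgebra.adjoin ℂ
      {T | ∃ (F : Finset ι) (a : ∀ i, E i →L[ℂ] E i), (∀ i ∈ F, a i ∈ A i) ∧ T = localOp F a},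
      (∀ v ∈ idps ζ, T v ∈ idps ζ) ∧ (∀ v ∈ idps ζ, (star T) v ∈ idps ζ) := by
    intro T hT
    induction hT using StarAlgebra.adjoin_induction with
    | mem T hT =>
      obtain ⟨F, a, -, rfl⟩ := hT
      refine ⟨localOp_mem_idps F a ζ, ?_⟩
      rw [star_localOp]
      exact localOp_mem_idps F _ ζ
    | algebraMap r =>
      refine ⟨fun v hv => Submodule.smul_mem _ r hv, fun v hv => ?_⟩
      rw [← algebraMap_star_comm]
      exact Submodule.smul_mem _ (star r) hv
    | add S T _ _ hS hT =>
      refine ⟨fun v hv => Submodule.add_mem _ (hS.1 v hv) (hT.1 v hv), fun v hv => ?_⟩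
      rw [star_add]
      exact Submodule.add_mem _ (hS.2 v hv) (hT.2 v hv)
    | mul S T _ _ hS hT =>
      refine ⟨fun v hv => hS.1 _ (hT.1 v hv), fun v hv => ?_⟩
      rw [star_mul]
      exact hT.2 _ (hS.2 v hv)
    | star T _ hT => exact ⟨hT.2, by rw [star_star]; exact hT.1⟩
  have hc : Continuous fun S : CTP E →L[ℂ] CTP E => S v := by fun_prop
  have hmem := map_mem_closure (t := (idps ζ : Set (CTP E))) hc hT fun S hS => (key S hS).1 v hv
  exact hcl.closure_subset hmem

/-- The representation of `⊗ A i` on the incomplete tensor product space of `ζ`; it maps `⊗ a i`,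
with almost all `a i` equal to `1`, to the operator `⊗ a i` on that space. -/
noncomputable def idpsRep (A : ∀ i, StarSubalgebra ℂ (E i →L[ℂ] E i)) (ζ : C0Family E) :
    tensorAlgebra A →⋆ₐ[ℂ] (idps ζ →L[ℂ] idps ζ) :=
  restrictRep (tensorAlgebra A) (idps ζ) (tensorAlgebra_mem_idps A ζ)

end Representations

end InfTensor

namespace SternGerlach

open InfTensor

/-- The Hilbert space `L²(ℝ)` of one atom. -/
abbrev L2R : Type := Lp ℂ 2 (volume : Measure ℝ)

theorem memLp_phase (β : ℝ) :
    MemLp (fun z : ℝ => Complex.exp (Complex.I * β * z)) ∞ (volume : Measure ℝ) := by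
  refine memLp_top_of_bound (Continuous.aestronglyMeasurable (by fun_prop)) 1
    (Eventually.of_forall fun z => ?_)
  have : Complex.I * β * z = ((β * z : ℝ) : ℂ) * Complex.I := by push_cast; ring
  rw [this, Complex.norm_exp_ofReal_mul_I]

/-- The operator `exp(i β z)`: multiplication by the function `z ↦ exp(i β z)`. -/
noncomputable def expPos (β : ℝ) : L2R →L[ℂ] L2R :=
  (ContinuousLinearMap.mul ℂ ℂ).holderL volume ∞ 2 2 (memLp_phase β).toLp

/-- The operator `exp(i γ p)`, where `p = -i d/dz`: the translation `f ↦ f (· + γ)`. -/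
noncomputable def expMom (γ : ℝ) : L2R →L[ℂ] L2R :=
  (Lp.compMeasurePreservingₗᵢ ℂ (fun z : ℝ => z + γ)
    (measurePreserving_add_right volume γ)).toContinuousLinearMap

/-- The Weyl operator `W(β, γ) = exp(i (β z + γ p))`, which maps `f` to
`z ↦ exp(i β γ / 2) exp(i β z) f (z + γ)`. -/
noncomputable def weyl (β γ : ℝ) : L2R →L[ℂ] L2R :=
  Complex.exp (Complex.I * β * γ / 2) • (expPos β ∘L expMom γ)

/-- The von Neumann algebra on `L²(ℝ)` generated by the Weyl operators: the bicommutant of the set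
of Weyl operators and their adjoints. -/
noncomputable def weylVNA : VonNeumannAlgebra L2R where
  __ := StarSubalgebra.centralizer ℂ
    (StarSubalgebra.centralizer ℂ {W : L2R →L[ℂ] L2R | ∃ β γ : ℝ, W = weyl β γ} : Set (L2R →L[ℂ] L2R))
  centralizer_centralizer' := by
    have h := StarSubalgebra.coe_centralizer_centralizer ℂ
      {W : L2R →L[ℂ] L2R | ∃ β γ : ℝ, W = weyl β γ}
    change Set.centralizer (Set.centralizer ((StarSubalgebra.centralizer ℂ _ :
      StarSubalgebra ℂ (L2R →L[ℂ] L2R)) : Set (L2R →L[ℂ] L2R))) = _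
    rw [h, Set.centralizer_centralizer_centralizer]
    exact h.symm

theorem expPos_mem (β : ℝ) : expPos β ∈ weylVNA.toStarSubalgebra := by
  have h0 : weyl β 0 = expPos β := by
    have : expMom 0 = ContinuousLinearMap.id ℂ L2R := by
      ext1 f
      refine Lp.ext ?_
      refine (Lp.coeFn_compMeasurePreserving f (measurePreserving_add_right volume (0 : ℝ))).trans ?_
      exact Eventually.of_forall fun z => by simp
    simp [weyl, this]
  have h := StarSubalgebra.coe_centralizer_centralizer ℂ
      {W : L2R →L[ℂ] L2R | ∃ β γ : ℝ, W = weyl β γ}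
  change expPos β ∈ ((StarSubalgebra.centralizer ℂ _ :
      StarSubalgebra ℂ (L2R →L[ℂ] L2R)) : Set (L2R →L[ℂ] L2R))
  rw [h]
  exact Set.subset_centralizer_centralizer (Or.inl ⟨β, 0, h0.symm⟩)

/-- The C*-algebra of the apparatus: the infinite tensor product over `ℤ` of copies of `weylVNA`. -/
noncomputable def apparatusAlgebra :
    StarSubalgebra ℂ (CTP (fun _ : ℤ => L2R) →L[ℂ] CTP (fun _ : ℤ => L2R)) :=
  tensorAlgebra fun _ : ℤ => weylVNA.toStarSubalgebra

/-- The element `exp(i ρ (z_{-k} + ⋯ + z_k) / (2k+1)) = ⊗_{i=-k}^{k} exp(i ρ z_i / (2k+1))` of the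
algebra of the apparatus. -/
noncomputable def expCM (ρ : ℝ) (k : ℕ) : apparatusAlgebra :=
  ⟨localOp (Finset.Icc (-(k : ℤ)) k) fun _ => expPos (ρ / (2 * k + 1)),
    localOp_mem_tensorAlgebra fun _ _ => expPos_mem _⟩

/-- The representation of the algebra of the apparatus on the incomplete tensor product space of
`ζ`. -/
noncomputable def apparatusRep (ζ : C0Family (fun _ : ℤ => L2R)) :
    apparatusAlgebra →⋆ₐ[ℂ] (idps ζ →L[ℂ] idps ζ) :=
  idpsRep (fun _ : ℤ => weylVNA.toStarSubalgebra) ζ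

/-- The normalized Gaussian wave function with width `σ₀` and center `a`. -/
noncomputable def gaussianWave (σ₀ a z : ℝ) : ℝ :=
  (2 * Real.pi * σ₀ ^ 2) ^ (-(1 / 4) : ℝ) * Real.exp (-(z - a) ^ 2 / (4 * σ₀ ^ 2))

theorem gaussianWave_sq {σ₀ : ℝ} (hσ : 0 < σ₀) (a z : ℝ) :
    gaussianWave σ₀ a z ^ 2 = ProbabilityTheory.gaussianPDFReal a (σ₀ ^ 2).toNNReal z := by
  unfold gaussianWave ProbabilityTheory.gaussianPDFReal
  have hv : ((σ₀ ^ 2).toNNReal : ℝ) = σ₀ ^ 2 := Real.coe_toNNReal _ (sq_nonneg _)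
  rw [hv, mul_pow, ← Real.exp_nat_mul, ← Real.rpow_natCast, ← Real.rpow_mul (by positivity),
    Real.sqrt_eq_rpow, ← Real.rpow_neg (by positivity)]
  congr 2
  · norm_num
  · push_cast
    field_simp
    ring

theorem memLp_gaussianWave {σ₀ : ℝ} (hσ : 0 < σ₀) (a : ℝ) :
    MemLp (fun z => (gaussianWave σ₀ a z : ℂ)) 2 (volume : Measure ℝ) := by
  have hc : Continuous (gaussianWave σ₀ a) := by unfold gaussianWave; fun_prop
  rw [memLp_two_iff_integrable_sq_norm (by fun_prop)]
  simp only [Complex.norm_real, Real.norm_eq_abs, sq_abs, gaussianWave_sq hσ]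
  exact ProbabilityTheory.integrable_gaussianPDFReal _ _

theorem norm_gaussianWave {σ₀ : ℝ} (hσ : 0 < σ₀) (a : ℝ) :
    ‖(memLp_gaussianWave hσ a).toLp _‖ = 1 := by
  have hv : (σ₀ ^ 2).toNNReal ≠ 0 := (Real.toNNReal_pos.2 (pow_pos hσ 2)).ne'
  have h := ProbabilityTheory.integral_gaussianPDFReal_eq_one a hv
  have h2 : ‖(memLp_gaussianWave hσ a).toLp _‖ ^ 2 = 1 := by
    rw [← h, ← inner_self_eq_norm_sq (𝕜 := ℂ), L2.inner_def, RCLike.re_to_complex]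
    have e : ∫ z, inner ℂ ((memLp_gaussianWave hσ a).toLp _ z) ((memLp_gaussianWave hσ a).toLp _ z)
        = ∫ z, ((ProbabilityTheory.gaussianPDFReal a (σ₀ ^ 2).toNNReal z : ℝ) : ℂ) := by
      refine integral_congr_ae ?_
      filter_upwards [(memLp_gaussianWave hσ a).coeFn_toLp] with z hz
      rw [hz, ← gaussianWave_sq hσ, inner_self_eq_norm_sq_to_K, Complex.norm_real,
        Real.norm_eq_abs]
      simp [← Complex.ofReal_pow]
    rw [e, integral_complex_ofReal, Complex.ofReal_re]
  exact (pow_eq_one_iff_of_nonneg (norm_nonneg _) two_ne_zero).1 h2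

/-- The `C₀` family over `ℤ` all of whose members are the Gaussian wave function with width `σ₀` and
center `a`. -/
noncomputable def gaussianFamily (σ₀ : ℝ) (hσ : 0 < σ₀) (a : ℝ) : C0Family (fun _ : ℤ => L2R) :=
  ⟨fun _ => (memLp_gaussianWave hσ a).toLp _, by simp [norm_gaussianWave hσ a]⟩

end SternGerlach

namespace InfTensor

/-! ### Infinite products of complex numbers: tails and finite truncations. -/

section InfiniteProducts

variable {ι : Type*}

/-! The limits are a law of large numbers, read off from characteristic functions. For the Gaussian
with center `a`, the expectation of `exp(iβz)` is `exp(iβa - σ₀²β²/2)`. With `β = ρ/(2k+1)`, the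
product of `2k+1` such factors is `exp(iρa - σ₀²ρ²/(2(2k+1)))`, which tends to `c = exp(iρa)`: the
variance is averaged out and the mean survives.

This becomes strong convergence because the operators are contractions. If `‖u_k‖ ≤ ‖w‖` and `⟪w,
u_k⟫ → ⟪w, w⟫`, then `u_k → w` in norm (`tendsto_of_tendsto_inner`), so one scalar limit per vector
is enough. It is computed in `tendsto_localOp_tprod` for product vectors that differ from the
Gaussian one in finitely many factors: the exceptional factors only contribute ratios of
expectations at `β → 0`, which are harmless.

Such vectors span a dense subspace of the IDPS (`idps_le_closure_span`), because replacing the tail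
of a family by that of an equivalent family changes its product vector arbitrarily little
(`tendsto_tprod_spliceFamily`). This rests on tails of absolutely convergent products tending to 1.
Uniform contractivity carries the limit to the whole IDPS (`tendsto_of_mem_closure_span`).

Disjointness follows: a unitary intertwiner between subrepresentations preserves strong limits, so
it would identify the scalar `exp(iρλT)` with `exp(-iρλT)` on a nonzero vector. For `ρ = π/(2λT)`
these are `i` and `-i`. -/

/-- The bound holds for each finite product and survives the limit. It is quantitative in the sum,
so it can be applied to tails. -/
theorem norm_tprod_sub_one_le {f : ι → ℂ} (hf : Summable fun i => ‖f i - 1‖) :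
    ‖∏' i, f i - 1‖ ≤ Real.exp (∑' i, ‖f i - 1‖) - 1 := by
  have hm : Multipliable f := by simpa using multipliable_one_add_of_summable (R := ℂ) hf
  have h1 : Tendsto (fun s : Finset ι => ‖∏ i ∈ s, f i - 1‖) atTop (𝓝 ‖∏' i, f i - 1‖) := by
    have : Tendsto (fun s : Finset ι => ∏ i ∈ s, f i) atTop (𝓝 (∏' i, f i)) := by
      simpa [HasProd] using hm.hasProd
    exact (this.sub_const 1).norm
  refine le_of_tendsto' h1 fun s => ?_
  have h2 := s.norm_prod_one_add_sub_one_le fun i => f i - 1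
  simp only [add_sub_cancel] at h2
  refine h2.trans (sub_le_sub_right (Real.exp_le_exp.2 ?_) _)
  exact hf.sum_le_tsum s fun _ _ => norm_nonneg _

theorem summable_ite_sub_one [DecidableEq ι] {f : ι → ℂ} (hf : Summable fun i => ‖f i - 1‖)
    (F : Finset ι) : Summable fun i => ‖(if i ∈ F then 1 else f i) - 1‖ := by
  refine Summable.of_nonneg_of_le (fun _ => norm_nonneg _) (fun i => ?_) hf
  split_ifs <;> simp

/-- The tail sums of `‖f i - 1‖` tend to 0, which forces the tail products to 1. Dividing the full
product by its partial products would not do, since factors may vanish. -/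
theorem tendsto_tprod_ite_one [DecidableEq ι] {f : ι → ℂ} (hf : Summable fun i => ‖f i - 1‖) :
    Tendsto (fun F : Finset ι => ∏' i, if i ∈ F then 1 else f i) atTop (𝓝 1) := by
  have hsum : ∀ F : Finset ι, ∑' i, ‖(if i ∈ F then 1 else f i) - 1‖
      = ∑' i, ‖f i - 1‖ - ∑ i ∈ F, ‖f i - 1‖ := by
    intro F
    have hF : ∑' i, (if i ∈ F then ‖f i - 1‖ else 0) = ∑ i ∈ F, ‖f i - 1‖ :=
      (tsum_eq_sum (s := F) fun b hb => if_neg hb).trans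
        (Finset.sum_congr rfl fun i hi => if_pos hi)
    rw [eq_sub_iff_add_eq', ← hF, ← Summable.tsum_add (summable_of_ne_finset_zero (s := F) fun b hb => if_neg hb)
        (summable_ite_sub_one hf F)]
    refine tsum_congr fun i => ?_
    split_ifs <;> simp
  have h0 : Tendsto (fun F : Finset ι => Real.exp (∑' i, ‖f i - 1‖ - ∑ i ∈ F, ‖f i - 1‖) - 1)
      atTop (𝓝 0) := by
    have h1 : Tendsto (fun F : Finset ι => ∑ i ∈ F, ‖f i - 1‖) atTop (𝓝 (∑' i, ‖f i - 1‖)) := by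
      simpa [HasSum] using hf.hasSum
    have h2 := (Real.continuous_exp.tendsto _).comp (h1.const_sub (∑' i, ‖f i - 1‖))
    simpa using h2.sub_const 1
  rw [tendsto_iff_norm_sub_tendsto_zero]
  refine squeeze_zero (fun _ => norm_nonneg _) (fun F => ?_) h0
  rw [← hsum]
  exact norm_tprod_sub_one_le (summable_ite_sub_one hf F)

theorem tprod_ite_eq_prod_mul [DecidableEq ι] {f : ι → ℂ} (hf : Summable fun i => ‖f i - 1‖)
    (g : ι → ℂ) (F : Finset ι) :
    ∏' i, (if i ∈ F then g i else f i) = (∏ i ∈ F, g i) * ∏' i, if i ∈ F then 1 else f i := by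
  have h1 : ∏' i, (if i ∈ F then g i else 1) = ∏ i ∈ F, g i :=
    (tprod_eq_prod (s := F) fun b hb => if_neg hb).trans
      (Finset.prod_congr rfl fun i hi => if_pos hi)
  have hm : Multipliable fun i => if i ∈ F then 1 else f i := by
    simpa using multipliable_one_add_of_summable (R := ℂ) (summable_ite_sub_one hf F)
  have hg : Multipliable fun i => if i ∈ F then g i else 1 :=
    multipliable_of_ne_finset_one (s := F) fun b hb => if_neg hb
  rw [← h1, ← hg.tprod_mul hm]
  refine tprod_congr fun i => ?_
  split_ifs <;> simp

/-- Finite product of `g` times tail of `f`: the former converges and the latter tends to 1. The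
factors are later inner products with a family whose tail has been replaced. -/
theorem tendsto_tprod_ite [DecidableEq ι] {f g : ι → ℂ} (hf : Summable fun i => ‖f i - 1‖)
    (hg : Multipliable g) :
    Tendsto (fun F : Finset ι => ∏' i, if i ∈ F then g i else f i) atTop (𝓝 (∏' i, g i)) := by
  have hg' : Tendsto (fun s : Finset ι => ∏ i ∈ s, g i) atTop (𝓝 (∏' i, g i)) := by
    simpa [HasProd] using hg.hasProd
  have h := hg'.mul (tendsto_tprod_ite_one hf)
  rw [mul_one] at h
  exact h.congr fun F => (tprod_ite_eq_prod_mul hf g F).symm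

end InfiniteProducts

/-! ### Strong convergence of contractions to a scalar. -/

section Hilbert

variable {H : Type*} [NormedAddCommGroup H] [InnerProductSpace ℂ H]

/-- Expanding the square and using the norm bound, `‖u - w‖² ≤ 2(‖w‖² - Re ⟪w, u⟫)`, and the right
side tends to 0. -/
theorem tendsto_of_tendsto_inner {α : Type*} {l : Filter α} {u : α → H} {w : H}
    (hn : ∀ᶠ a in l, ‖u a‖ ≤ ‖w‖) (hi : Tendsto (fun a => inner ℂ w (u a)) l (𝓝 (inner ℂ w w))) :
    Tendsto u l (𝓝 w) := by
  have h1 : Tendsto (fun a => 2 * (‖w‖ ^ 2 - (inner ℂ w (u a)).re)) l (𝓝 0) := by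
    have h2 := ((Complex.continuous_re.tendsto _).comp hi).const_sub (‖w‖ ^ 2) |>.const_mul 2
    have h3 : (inner ℂ w w : ℂ).re = ‖w‖ ^ 2 := by
      rw [← inner_self_eq_norm_sq (𝕜 := ℂ)]; rfl
    rw [h3, sub_self, mul_zero] at h2
    exact h2
  have h4 : Tendsto (fun a => ‖u a - w‖ ^ 2) l (𝓝 0) := by
    refine squeeze_zero' (Eventually.of_forall fun _ => by positivity) ?_ h1
    filter_upwards [hn] with a ha
    rw [norm_sub_rev, @norm_sub_sq ℂ, RCLike.re_to_complex]
    have := pow_le_pow_left₀ (norm_nonneg _) ha 2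
    linarith
  rw [tendsto_iff_norm_sub_tendsto_zero]
  have h5 := (Real.continuous_sqrt.tendsto _).comp h4
  simpa [Function.comp_def, Real.sqrt_sq] using h5

theorem tendsto_of_mem_closure_span {u : ℕ → H →L[ℂ] H} (hu : ∀ k v, ‖u k v‖ ≤ ‖v‖) {c : ℂ}
    (D : Set H) (hD : ∀ v ∈ D, Tendsto (fun k => u k v) atTop (𝓝 (c • v))) {v : H}
    (hv : v ∈ (Submodule.span ℂ D).topologicalClosure) :
    Tendsto (fun k => u k v) atTop (𝓝 (c • v)) := by
  have hspan : ∀ w ∈ Submodule.span ℂ D, Tendsto (fun k => u k w) atTop (𝓝 (c • w)) := by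
    intro w hw
    induction hw using Submodule.span_induction with
    | mem w hw => exact hD w hw
    | zero => simp
    | add w w' _ _ h h' => simpa [smul_add] using h.add h'
    | smul b w _ h => simpa [smul_comm c b] using h.const_smul b
  rw [Metric.tendsto_atTop]
  intro ε hε
  -- With `δ = ε/(2+‖c‖)` the three errors below are at most `δ`, `δ` and `‖c‖δ`, which add up to
  -- `ε`.
  have hδ : 0 < ε / (2 + ‖c‖) := by positivity
  obtain ⟨w, hw, hvw⟩ := Metric.mem_closure_iff.1 hv _ hδ
  obtain ⟨N, hN⟩ := Metric.tendsto_atTop.1 (hspan w hw) _ hδ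
  refine ⟨N, fun k hk => ?_⟩
  have h1 : dist (u k v) (u k w) ≤ dist v w := by
    rw [dist_eq_norm, dist_eq_norm, ← map_sub]; exact hu k _
  have h2 : dist (c • w) (c • v) = ‖c‖ * dist v w := by rw [dist_smul₀, dist_comm]
  have h3 := hN k hk
  have h4 : ‖c‖ * dist v w ≤ ‖c‖ * (ε / (2 + ‖c‖)) := by gcongr
  calc dist (u k v) (c • v) ≤ dist (u k v) (u k w) + dist (u k w) (c • w) + dist (c • w) (c • v) :=
        dist_triangle4 _ _ _ _
    _ < ε / (2 + ‖c‖) + ε / (2 + ‖c‖) + ‖c‖ * (ε / (2 + ‖c‖)) := by linarith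
    _ = ε := by field_simp; ring

end Hilbert

/-! ### Contractive local operators and density of finite modifications. -/

section Tensor

variable {ι : Type*} {E : ι → Type*} [∀ i, NormedAddCommGroup (E i)]
  [∀ i, InnerProductSpace ℂ (E i)]

theorem localOp_insert [DecidableEq ι] {F : Finset ι} {i : ι} (hi : i ∉ F)
    (a : ∀ i, E i →L[ℂ] E i) : localOp (insert i F) a = (localOp {i} a).comp (localOp F a) := by
  refine CTP.ext_tprod fun x => ?_
  rw [ContinuousLinearMap.comp_apply, localOp_tprod, localOp_tprod, localOp_tprod,
    mapFamily_insert hi]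

theorem norm_localOp_singleton_apply_le (i : ι) (a : ∀ i, E i →L[ℂ] E i) (v : CTP E) :
    ‖localOp {i} a v‖ ≤ ‖a i‖ * ‖v‖ := by
  induction v using CTP.denseRange_linearCombination.induction_on with
  | hp => exact isClosed_le (by fun_prop) (by fun_prop)
  | ih c =>
    refine le_trans (le_of_eq (congrArg norm ?_)) (norm_mapFamily_singleton_le i a c)
    simp [Finsupp.linearCombination_apply, Finsupp.sum, localOp_tprod]

theorem norm_localOp_apply_le (F : Finset ι) (a : ∀ i, E i →L[ℂ] E i) (ha : ∀ i ∈ F, ‖a i‖ ≤ 1)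
    (v : CTP E) : ‖localOp F a v‖ ≤ ‖v‖ := by
  classical
  induction F using Finset.induction_on with
  | empty =>
    have : localOp ∅ a = ContinuousLinearMap.id ℂ (CTP E) := by
      refine CTP.ext_tprod fun x => ?_
      rw [localOp_tprod]
      exact congrArg CTP.tprod (Subtype.ext (funext fun j => mapFamily_of_notMem (by simp) a x))
    simp [this]
  | insert i F hi ih =>
    rw [localOp_insert hi, ContinuousLinearMap.comp_apply]
    refine (norm_localOp_singleton_apply_le i a _).trans ?_
    refine (mul_le_of_le_one_left (norm_nonneg _) (ha i (Finset.mem_insert_self _ _))).trans ?_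
    exact ih fun j hj => ha j (Finset.mem_insert_of_mem hj)

open Classical in
/-- The family which agrees with `x` on the finite set `F` and with `ζ` elsewhere. -/
noncomputable def spliceFamily (x ζ : C0Family E) (F : Finset ι) : C0Family E :=
  ⟨fun i => if i ∈ F then x i else ζ i, by
    refine ζ.2.congr_cofinite ?_
    filter_upwards [F.finite_toSet.compl_mem_cofinite] with i hi
    have : i ∉ F := hi
    simp [this]⟩

theorem equiv_of_forall_notMem {x ζ : C0Family E} {F : Finset ι} (h : ∀ i ∉ F, x i = ζ i) :
    x.Equiv ζ := by
  refine Summable.congr_cofinite (C0Family.equiv_refl ζ) ?_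
  filter_upwards [F.finite_toSet.compl_mem_cofinite] with i hi
  rw [h i hi]

theorem prodInner_of_equiv {x y : C0Family E} (h : x.Equiv y) :
    prodInner x y = ∏' i, inner ℂ (x i) (y i) := if_pos h

/-- Both `⟪x, s_F⟫` and `⟪s_F, s_F⟫`, for the spliced family `s_F`, tend to `⟪x, x⟫`: their tail
factors are `⟪x i, ζ i⟫`, controlled by the equivalence, and `⟪ζ i, ζ i⟫`, controlled by the `C₀`
condition. -/
theorem tendsto_tprod_spliceFamily {x ζ : C0Family E} (h : x.Equiv ζ) :
    Tendsto (fun F => CTP.tprod (spliceFamily x ζ F)) atTop (𝓝 (CTP.tprod x)) := by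
  classical
  have hs : ∀ F, (spliceFamily x ζ F).Equiv ζ := fun F =>
    equiv_of_forall_notMem (F := F) fun i hi => if_neg hi
  have hxx := (C0Family.equiv_refl x).multipliable
  have hss : Tendsto (fun F => prodInner (spliceFamily x ζ F) (spliceFamily x ζ F)) atTop
      (𝓝 (prodInner x x)) := by
    rw [prodInner_of_equiv (C0Family.equiv_refl x)]
    refine (tendsto_tprod_ite (C0Family.equiv_refl ζ) hxx).congr fun F => ?_
    rw [prodInner_of_equiv (C0Family.equiv_refl _)]
    refine tprod_congr fun i => ?_
    by_cases hi : i ∈ F <;> simp [spliceFamily, hi]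
  have hxs : Tendsto (fun F => prodInner x (spliceFamily x ζ F)) atTop (𝓝 (prodInner x x)) := by
    rw [prodInner_of_equiv (C0Family.equiv_refl x)]
    refine (tendsto_tprod_ite h hxx).congr fun F => ?_
    rw [prodInner_of_equiv (h.trans (hs F).symm)]
    refine tprod_congr fun i => ?_
    by_cases hi : i ∈ F <;> simp [spliceFamily, hi]
  have hre : ∀ y : C0Family E, (prodInner y y).re = ‖CTP.tprod y‖ ^ 2 := fun y => by
    rw [← CTP.inner_tprod, ← inner_self_eq_norm_sq (𝕜 := ℂ)]; rfl
  have h1 : Tendsto (fun F => ‖CTP.tprod x - CTP.tprod (spliceFamily x ζ F)‖ ^ 2) atTop (𝓝 0) := by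
    have h2 := ((((Complex.continuous_re.tendsto _).comp hxs).const_mul 2).const_sub
      (‖CTP.tprod x‖ ^ 2)).add ((Complex.continuous_re.tendsto _).comp hss)
    rw [hre] at h2
    -- The limit is `‖x‖² - 2‖x‖² + ‖x‖²`, which is 0.
    refine (h2.congr fun F => ?_).trans (le_of_eq (by ring_nf))
    rw [@norm_sub_sq ℂ, CTP.inner_tprod, RCLike.re_to_complex, Function.comp_apply,
      Function.comp_apply, hre]
  rw [tendsto_iff_norm_sub_tendsto_zero]
  have h5 := (Real.continuous_sqrt.tendsto _).comp h1
  simpa [Function.comp_def, Real.sqrt_sq, norm_sub_rev] using h5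

/-- Reduces strong limits on the IDPS to vectors whose factors equal those of `ζ` off a finite set,
where the infinite products become finite ones when `ζ` consists of unit vectors. -/
theorem idps_le_closure_span (ζ : C0Family E) :
    idps ζ ≤ (Submodule.span ℂ
      (CTP.tprod '' {x : C0Family E | ∃ F : Finset ι, ∀ i ∉ F, x i = ζ i})).topologicalClosure := by
  refine Submodule.topologicalClosure_minimal _ (Submodule.span_le.2 ?_)
    (Submodule.isClosed_topologicalClosure _)
  rintro _ ⟨x, hx, rfl⟩
  refine mem_closure_of_tendsto (tendsto_tprod_spliceFamily hx) (Eventually.of_forall fun F => ?_)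
  exact Submodule.subset_span ⟨_, ⟨F, fun i hi => if_neg hi⟩, rfl⟩

end Tensor

/-! ### Disjointness from different scalar limits. -/

/-- Two representations are disjoint if some sequence in the algebra converges strongly to different
scalars in them. -/
theorem disjointReps_of_tendsto {A H₁ H₂ : Type*} [Semiring A] [Algebra ℂ A] [Star A]
    [NormedAddCommGroup H₁] [InnerProductSpace ℂ H₁] [CompleteSpace H₁]
    [NormedAddCommGroup H₂] [InnerProductSpace ℂ H₂] [CompleteSpace H₂]
    {π₁ : A →⋆ₐ[ℂ] (H₁ →L[ℂ] H₁)} {π₂ : A →⋆ₐ[ℂ] (H₂ →L[ℂ] H₂)} (a : ℕ → A) {c₁ c₂ : ℂ}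
    (hc : c₁ ≠ c₂) (h₁ : ∀ v, Tendsto (fun k => π₁ (a k) v) atTop (𝓝 (c₁ • v)))
    (h₂ : ∀ v, Tendsto (fun k => π₂ (a k) v) atTop (𝓝 (c₂ • v))) : DisjointReps π₁ π₂ := by
  rintro M₁ M₂ - - hM hi₁ hi₂ ⟨U, hU⟩
  obtain ⟨v, hv, hv0⟩ := M₁.ne_bot_iff.1 hM
  let w : M₁ := ⟨v, hv⟩
  have ht : Tendsto (fun k => (⟨π₁ (a k) w, hi₁ (a k) w w.2⟩ : M₁)) atTop (𝓝 (c₁ • w)) :=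
    tendsto_subtype_rng.2 (h₁ v)
  have ht₁ := (continuous_subtype_val.tendsto _).comp ((U.continuous.tendsto _).comp ht)
  have ht₂ : Tendsto (fun k => (U ⟨π₁ (a k) w, hi₁ (a k) w w.2⟩ : H₂)) atTop
      (𝓝 (c₂ • (U w : H₂))) := by
    simp only [hU]
    exact h₂ _
  -- By the intertwining relation one sequence has the limits `U (c₁ • w)` and `c₂ • U w`.
  have he := tendsto_nhds_unique ht₁ ht₂
  rw [map_smul, Submodule.coe_smul, ← sub_eq_zero, ← sub_smul, smul_eq_zero, sub_eq_zero] at he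
  have hw : (U w : H₂) ≠ 0 := by
    intro h
    have : w = 0 := by simpa using h
    exact hv0 (congrArg Subtype.val this)
  exact he.elim hc hw

end InfTensor

/-! ### One atom: expectations of `exp(iβz)`. -/

namespace SternGerlach

open InfTensor

theorem norm_exp_I_mul (β z : ℝ) : ‖Complex.exp (Complex.I * β * z)‖ = 1 := by
  have : Complex.I * β * z = ((β * z : ℝ) : ℂ) * Complex.I := by push_cast; ring
  rw [this, Complex.norm_exp_ofReal_mul_I]

theorem coeFn_expPos (β : ℝ) (f : L2R) :
    expPos β f =ᵐ[volume] fun z => Complex.exp (Complex.I * β * z) * f z := by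
  have h := ContinuousLinearMap.coeFn_holder (r := 2) (ContinuousLinearMap.mul ℂ ℂ)
    (memLp_phase β).toLp f
  filter_upwards [h, (memLp_phase β).coeFn_toLp] with z h1 h2
  rw [← h2]
  exact h1

theorem norm_expPos_le (β : ℝ) : ‖expPos β‖ ≤ 1 := by
  refine ContinuousLinearMap.opNorm_le_bound _ zero_le_one fun f => ?_
  rw [one_mul]
  refine Lp.norm_le_norm_of_ae_le ?_
  filter_upwards [coeFn_expPos β f] with z hz
  rw [hz, norm_mul, norm_exp_I_mul, one_mul]

theorem inner_expPos (β : ℝ) (f : L2R) :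
    inner ℂ f (expPos β f) = ∫ z : ℝ, Complex.exp (Complex.I * β * z) * ((‖f z‖ ^ 2 : ℝ) : ℂ) := by
  rw [L2.inner_def]
  refine integral_congr_ae ?_
  filter_upwards [coeFn_expPos β f] with z hz
  have h := inner_self_eq_norm_sq_to_K (𝕜 := ℂ) (f z)
  simp only [RCLike.inner_apply] at h ⊢
  rw [hz, mul_assoc, h]
  push_cast
  rfl

/-- Dominated convergence with dominating function `‖f z‖²`. It handles the finitely many
non-Gaussian factors, of which nothing more is known than that they lie in `L²`. -/
theorem tendsto_inner_expPos (f : L2R) :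
    Tendsto (fun β => inner ℂ f (expPos β f)) (𝓝 0) (𝓝 (inner ℂ f f)) := by
  have hint : Integrable (fun z => ‖f z‖ ^ 2) volume :=
    (memLp_two_iff_integrable_sq_norm (Lp.aestronglyMeasurable f)).1 (Lp.memLp f)
  have h0 : inner ℂ f f
      = ∫ z : ℝ, Complex.exp (Complex.I * (0 : ℝ) * z) * ((‖f z‖ ^ 2 : ℝ) : ℂ) := by
    rw [L2.inner_def]
    refine integral_congr_ae (Eventually.of_forall fun z => ?_)
    simp [inner_self_eq_norm_sq_to_K]
  simp only [h0, inner_expPos]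
  refine tendsto_integral_filter_of_dominated_convergence _ ?_ ?_ hint ?_
  · refine Eventually.of_forall fun β => AEStronglyMeasurable.mul ?_ ?_
    · exact Continuous.aestronglyMeasurable (by fun_prop)
    · exact Complex.continuous_ofReal.comp_aestronglyMeasurable hint.1
  · refine Eventually.of_forall fun β => Eventually.of_forall fun z => ?_
    rw [norm_mul, norm_exp_I_mul, one_mul, Complex.norm_real, norm_pow, norm_norm]
  · refine Eventually.of_forall fun z => Continuous.tendsto (f := fun β : ℝ =>
      Complex.exp (Complex.I * β * z) * ((‖f z‖ ^ 2 : ℝ) : ℂ)) (by fun_prop) 0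

/-- The squared wave function is the density of the normal law with mean `a` and variance `σ₀²`, so
this is its characteristic function at `β`. -/
theorem inner_expPos_gaussianWave {σ₀ : ℝ} (hσ : 0 < σ₀) (a β : ℝ) :
    inner ℂ ((memLp_gaussianWave hσ a).toLp _) (expPos β ((memLp_gaussianWave hσ a).toLp _))
      = Complex.exp (Complex.I * β * a - σ₀ ^ 2 * β ^ 2 / 2) := by
  have hv : (σ₀ ^ 2).toNNReal ≠ 0 := (Real.toNNReal_pos.2 (pow_pos hσ 2)).ne'
  have h := ProbabilityTheory.charFun_gaussianReal (μ := a) (v := (σ₀ ^ 2).toNNReal) β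
  rw [charFun_apply_real, ProbabilityTheory.integral_gaussianReal_eq_integral_smul hv] at h
  rw [inner_expPos]
  have e : Complex.exp (Complex.I * β * a - σ₀ ^ 2 * β ^ 2 / 2)
      = Complex.exp (β * a * Complex.I - (σ₀ ^ 2).toNNReal * β ^ 2 / 2) := by
    have hr : (((σ₀ ^ 2).toNNReal : ℝ) : ℂ) = (σ₀ : ℂ) ^ 2 := by
      rw [Real.coe_toNNReal _ (sq_nonneg _)]; push_cast; rfl
    rw [hr]
    congr 1
    ring
  rw [e]
  refine Eq.trans (integral_congr_ae ?_) h
  filter_upwards [(memLp_gaussianWave hσ a).coeFn_toLp] with z hz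
  rw [hz, Complex.norm_real, Real.norm_eq_abs, sq_abs, gaussianWave_sq hσ, Complex.real_smul,
    mul_comm]
  congr 2
  ring

/-! ### The law of large numbers on the IDPS of a Gaussian family. -/

theorem tendsto_localOp_tprod {σ₀ : ℝ} (hσ : 0 < σ₀) (a ρ : ℝ)
    {x : C0Family (fun _ : ℤ => L2R)} {S : Finset ℤ}
    (hx : ∀ i ∉ S, x i = gaussianFamily σ₀ hσ a i) :
    Tendsto (fun k : ℕ => localOp (Finset.Icc (-(k : ℤ)) k)
      (fun _ => expPos (ρ / (2 * k + 1))) (CTP.tprod x)) atTop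
      (𝓝 (Complex.exp (Complex.I * ρ * a) • CTP.tprod x)) := by
  set g : L2R := (memLp_gaussianWave hσ a).toLp _ with hg
  set c := Complex.exp (Complex.I * ρ * a) with hc
  have hcn : ‖c‖ = 1 := norm_exp_I_mul ρ a
  let φ : ℝ → ℂ := fun β => inner ℂ g (expPos β g)
  have hφ : ∀ β : ℝ, φ β = Complex.exp (Complex.I * β * a - σ₀ ^ 2 * β ^ 2 / 2) :=
    inner_expPos_gaussianWave hσ a
  have hφ0 : ∀ β, φ β ≠ 0 := fun β => by rw [hφ]; exact Complex.exp_ne_zero _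
  have hgg : inner ℂ g g = (1 : ℂ) := by
    rw [inner_self_eq_norm_sq_to_K, hg, norm_gaussianWave hσ]; simp
  have hN : Tendsto (fun k : ℕ => (2 * k + 1 : ℝ)) atTop atTop :=
    tendsto_atTop_add_const_right _ _
      (tendsto_natCast_atTop_atTop.const_mul_atTop (by norm_num))
  have hβ : Tendsto (fun k : ℕ => ρ / (2 * k + 1)) atTop (𝓝 0) := hN.const_div_atTop ρ
  -- With `β = ρ/(2k+1)`, the exponent `(2k+1)(iβa - σ₀²β²/2)` equals `iρa - (σ₀²ρ/2)β`, and `β →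
  -- 0`.
  have hpow : Tendsto (fun k : ℕ => φ (ρ / (2 * k + 1)) ^ (2 * k + 1)) atTop (𝓝 c) := by
    have h1 : Tendsto (fun k : ℕ => Complex.exp (Complex.I * ρ * a
        - σ₀ ^ 2 * ρ / 2 * ((ρ / (2 * k + 1) : ℝ) : ℂ))) atTop (𝓝 c) := by
      have h2 := ((Complex.continuous_ofReal.tendsto _).comp hβ).const_mul
        ((σ₀ : ℂ) ^ 2 * ρ / 2) |>.const_sub (Complex.I * ρ * a)
      rw [Complex.ofReal_zero, mul_zero, sub_zero] at h2
      exact (Complex.continuous_exp.tendsto _).comp h2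
    refine h1.congr fun k => ?_
    rw [hφ, ← Complex.exp_nat_mul]
    congr 1
    have : (2 * (k : ℂ) + 1) ≠ 0 := by exact_mod_cast (by omega : 2 * k + 1 ≠ 0)
    push_cast
    field_simp
  -- Correction for the exceptional sites: each ratio compares the true factor with the Gaussian
  -- one, whose expectation is never zero and tends to `⟪g, g⟫ = 1`.
  have hprod : Tendsto (fun k : ℕ => ∏ i ∈ S, inner ℂ (x i) (expPos (ρ / (2 * k + 1)) (x i))
      / φ (ρ / (2 * k + 1))) atTop (𝓝 (∏ i ∈ S, inner ℂ (x i) (x i))) := by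
    refine tendsto_finsetProd _ fun i _ => ?_
    have h1 := ((tendsto_inner_expPos (x i)).comp hβ).div ((tendsto_inner_expPos g).comp hβ)
      (by rw [hgg]; exact one_ne_zero)
    rwa [hgg, div_one] at h1
  have hself : prodInner x x = ∏ i ∈ S, inner ℂ (x i) (x i) := by
    rw [prodInner_of_equiv (C0Family.equiv_refl x)]
    refine tprod_eq_prod fun i hi => ?_
    rw [hx i hi]
    exact hgg
  -- Applied with `w = c • ⊗x`; since `‖c‖ = 1`, contractivity gives the required norm bound.
  refine tendsto_of_tendsto_inner (Eventually.of_forall fun k => ?_) ?_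
  · rw [norm_smul, hcn, one_mul]
    exact norm_localOp_apply_le _ _ (fun _ _ => norm_expPos_le _) _
  simp only [inner_smul_left, inner_smul_right, localOp_tprod, CTP.inner_tprod]
  rw [mul_left_comm, hself]
  refine Tendsto.const_mul _ ?_
  refine (hpow.mul hprod).congr' ?_
  obtain ⟨K, hK⟩ : ∃ K : ℕ, ∀ k ≥ K, S ⊆ Finset.Icc (-(k : ℤ)) k := by
    refine ⟨S.sup Int.natAbs, fun k hk i hi => ?_⟩
    have := (Finset.le_sup (f := Int.natAbs) hi).trans hk
    rw [Finset.mem_Icc]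
    omega
  filter_upwards [eventually_ge_atTop K] with k hk
  set e := expPos (ρ / (2 * k + 1))
  set b := φ (ρ / (2 * k + 1)) with hb
  set F := Finset.Icc (-(k : ℤ)) k with hF
  have hcard : F.card = 2 * k + 1 := by rw [hF, Int.card_Icc]; omega
  -- Sites of `F` outside `S` contribute the ratio 1, so the correction may be taken over all of
  -- `F`; its denominators then cancel the power `b ^ (2k+1)`.
  have h1 : ∏ i ∈ S, inner ℂ (x i) (e (x i)) / b = ∏ i ∈ F, inner ℂ (x i) (e (x i)) / b := by
    refine Finset.prod_subset (hK k hk) fun i _ hi => ?_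
    rw [hx i hi]
    exact div_self (hφ0 _)
  rw [h1, Finset.prod_div_distrib, Finset.prod_const, hcard,
    mul_div_cancel₀ _ (pow_ne_zero _ (hφ0 _)),
    prodInner_of_equiv (mapFamily_equiv F (fun _ => e) x).symm]
  -- Off `F`, which contains `S`, the operator acts trivially and the factor is `⟪g, g⟫ = 1`.
  rw [tprod_eq_prod (s := F)]
  · exact Finset.prod_congr rfl fun i hi => by rw [mapFamily_of_mem hi]
  · intro i hi
    rw [mapFamily_of_notMem hi, hx i fun h => hi (hK k hk h)]
    exact hgg

theorem tendsto_apparatusRep_expCM {σ₀ : ℝ} (hσ : 0 < σ₀) (a ρ : ℝ)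
    (v : idps (gaussianFamily σ₀ hσ a)) :
    Tendsto (fun k : ℕ => apparatusRep _ (expCM ρ k) v) atTop
      (𝓝 (Complex.exp (Complex.I * ρ * a) • v)) := by
  refine tendsto_subtype_rng.2 ?_
  refine tendsto_of_mem_closure_span (u := fun k : ℕ => localOp (Finset.Icc (-(k : ℤ)) k)
    fun _ => expPos (ρ / (2 * k + 1)))
    (fun k => norm_localOp_apply_le _ _ fun _ _ => norm_expPos_le _) _ ?_
    (idps_le_closure_span _ v.2)
  rintro _ ⟨x, ⟨S, hx⟩, rfl⟩
  exact tendsto_localOp_tprod hσ a ρ hx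

end SternGerlach

/-! ### The two Gaussian families with opposite centers. -/

theorem proposition4p2 (σ₀ lam T : ℝ) (hσ : 0 < σ₀) (hlam : lam ≠ 0) (hT : 0 < T) :
    (∀ (ρ : ℝ) (v : InfTensor.idps (SternGerlach.gaussianFamily σ₀ hσ (lam * T))),
      Tendsto (fun k : ℕ => SternGerlach.apparatusRep _ (SternGerlach.expCM ρ k) v) atTop
        (𝓝 (Complex.exp (Complex.I * ρ * lam * T) • v))) ∧
    (∀ (ρ : ℝ) (v : InfTensor.idps (SternGerlach.gaussianFamily σ₀ hσ (-(lam * T)))),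
      Tendsto (fun k : ℕ => SternGerlach.apparatusRep _ (SternGerlach.expCM ρ k) v) atTop
        (𝓝 (Complex.exp (-(Complex.I * ρ * lam * T)) • v))) ∧
    InfTensor.DisjointReps
      (SternGerlach.apparatusRep (SternGerlach.gaussianFamily σ₀ hσ (lam * T)))
      (SternGerlach.apparatusRep (SternGerlach.gaussianFamily σ₀ hσ (-(lam * T)))) := by
  have h₁ : ∀ (ρ : ℝ) (v : InfTensor.idps (SternGerlach.gaussianFamily σ₀ hσ (lam * T))),
      Tendsto (fun k : ℕ => SternGerlach.apparatusRep _ (SternGerlach.expCM ρ k) v) atTop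
        (𝓝 (Complex.exp (Complex.I * ρ * lam * T) • v)) := fun ρ v => by
    have h := SternGerlach.tendsto_apparatusRep_expCM hσ (lam * T) ρ v
    rwa [Complex.ofReal_mul, ← mul_assoc] at h
  have h₂ : ∀ (ρ : ℝ) (v : InfTensor.idps (SternGerlach.gaussianFamily σ₀ hσ (-(lam * T)))),
      Tendsto (fun k : ℕ => SternGerlach.apparatusRep _ (SternGerlach.expCM ρ k) v) atTop
        (𝓝 (Complex.exp (-(Complex.I * ρ * lam * T)) • v)) := fun ρ v => by
    have h := SternGerlach.tendsto_apparatusRep_expCM hσ (-(lam * T)) ρ v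
    rwa [Complex.ofReal_neg, Complex.ofReal_mul, mul_neg, ← mul_assoc] at h
  refine ⟨h₁, h₂, ?_⟩
  -- This `ρ` makes the phase `ρλT` equal to `π/2`, so that the two scalars are `i` and `-i`.
  refine InfTensor.disjointReps_of_tendsto
    (SternGerlach.expCM (Real.pi / 2 / (lam * T))) ?_ (h₁ _) (h₂ _)
  have he : Complex.I * ((Real.pi / 2 / (lam * T) : ℝ) : ℂ) * lam * T
      = Real.pi / 2 * Complex.I := by
    have h1 : (lam : ℂ) ≠ 0 := Complex.ofReal_ne_zero.2 hlam
    have h2 : (T : ℂ) ≠ 0 := Complex.ofReal_ne_zero.2 hT.ne'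
    push_cast
    field_simp
  rw [he, Complex.exp_neg, Complex.exp_pi_div_two_mul_I, Complex.inv_I]
  intro h
  have := congrArg Complex.im h
  norm_num at this
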